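/- **Setting.** Let $K=(\mathbb C^\times)^{r}$ with cocharacter lattice $\mathbb L$, let $D_1,\dots,D_m\in\mathbb L^\vee$, and for a stability condition $\omega\in\mathbb L^\vee\otimes\mathbb R$ let $\angle_I$ ($I\subset\{1,\dots,m\}$) be the cone of strictly positive combinations of the $D_i$, $i\in I$, $\mathcal A_\omega=\{I:\omega\in\angle_I\}$, $C_\omega=\bigcap_{I\in\mathcal A_\omega}\angle_I$, and $X_\omega=[\mathcal U_\omega/K]$, where $\mathcal U_\omega\subset\mathbb C^m$ is the set of points $z$ with $\{i:z_i\ne0\}\in\mathcal A_\omega$. Put $\mathbb K_\omega=\{d\in\mathbb L\otimes\mathbb Q:\{i:D_i\cdot d\in\mathbb Z\}\in\mathcal A_\omega\}$. Let $X_+\dashrightarrow X_-$ be a single toric wall-crossing: $X_\pm=X_{\omega_\pm}$ for stability conditions $\omega_\pm$ in the nonnegative span of the $D_i$ whose chambers $C_\pm$ are of full dimension and are separated by a hyperplane $W$, with $W\cap\overline{C_+}=W\cap\overline{C_-}=:\overline{C_W}$ a facet of both; $e\in\mathbb L$ is the primitive generator of $W^\perp$ with $\omega_+\cdot e>0>\omega_-\cdot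 e$. Write $\mathbb K_\pm=\mathbb K_{\omega_\pm}$, $M_0=\{i:D_i\cdot e=0\}$, $S_\pm=\{i:\{1,\dots,m\}\setminus\{i\}\notin\mathcal A_{\omega_\pm}\}$ and $I_\pm=\{i:D_i\cdot e\neq0\}\setminus S_\pm$. Let $p_1^\pm,\dots,p_r^\pm\in\overline{C_\pm}$ be $\mathbb Z$-bases of the lattices of those $\theta\in\mathbb L^\vee\otimes\mathbb Q$ that are integral on $\mathbb K_\pm$, with $p_a^+=p_a^-\in\overline{C_W}$ for $a<r$. Use coordinates $y$ for $X_+$ and $\tilde y$ for $X_-$, $y^d=\prod_a y_a^{p_a^+\cdot d}$, $\tilde y^d=\prod_a\tilde y_a^{p_a^-\cdot d}$, $t_+=\sum_a p_a^+\log y_a$, $t_-=\sum_a p_a^-\log\tilde y_a$, and the change of variables $$\tilde y_a=y_a\,y_r^{c_a}\ (a<r),\qquad \tilde y_r=y_r^{-c},\qquad c=-\frac{p_r^+\cdot e}{p_r^-\cdot e},\qquad p_r^+=\sum_{a<r}c_a\,p_a^--c\,p_r^-$$ (all powers and logarithms are taken in terms of a choice of the $\log y_a$, transported by this rule). Let $E_1,E_2\in\mathbb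 L^\vee\cap\overline{C_W}$ be characters with classes $v_1,v_2$, whose line bundles $L_{i,\pm}$ on $X_\pm$ are pulled back from the coarse moduli spaces, and let $s_{i,\pm}$ be regular sections of $L_{i,\pm}$, compatible under $X_+\dashrightarrow X_-$. Exchange the roles of the two bundles: $Z_+=\{s_{1,+}=0\}\subset X_+$ carries $D_{Z,+}=(D_{2,+}+D_+)\cap Z_+$, and $Z_-=\{s_{2,-}=0\}\subset X_-$ carries $D_{Z,-}=(D_{1,-}+D_-)\cap Z_-$, where $D_{i,\pm}=\{s_{i,\pm}=0\}$ and $D_\pm=\sum_{i\in I_\pm}\{z_i=0\}$. The ambient relative $H$-functions of the pairs are the formal sums $H_{(Z_\pm,D_{Z,\pm})}=\sum_{d\in\mathbb K_\pm}H_{\pm,d}\,\mathbf 1_{[d]}[\mathbf 1]_{\vec d_\pm}$, with $[d]\in(\mathbb L\otimes\mathbb Q)/\mathbb L$, with contact orders $\vec d_+=((D_i\cdot d)_{i\in I_+},v_2\cdot d)$ and $\vec d_-=((D_i\cdot d)_{i\in I_-},v_1\cdot d)$, and with $$H_{+,d}(y)=e^{\frac{t_+}{2\pi i}}\,y^d\,\frac{\prod_{j=1}^2\Gamma(1+\frac{v_j}{2\pi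 i}+v_j\cdot d)}{\prod_{i\in M_0}\Gamma(1+\frac{D_i}{2\pi i}+D_i\cdot d)},\qquad H_{-,d}(\tilde y)=e^{\frac{t_-}{2\pi i}}\,\tilde y^d\,\frac{\prod_{j=1}^2\Gamma(1+\frac{v_j}{2\pi i}+v_j\cdot d)}{\prod_{i\in M_0}\Gamma(1+\frac{D_i}{2\pi i}+D_i\cdot d)}$$ (and $H_{\pm,d}=0$ if some $v_j\cdot d<0$). These are power series in the classes of the characters of $K$. The component of class $d$ is the image of $H_{\pm,d}$ in the cohomology (a quotient of the ring of such series by a Stanley–Reisner ideal) of the closed substack of the sector $X_\pm^{[d]}$ cut out by the divisors $\{z_i=0\}$, $i\in I_\pm$, with $D_i\cdot d\neq0$; labels $\mathbf 1_{[d]}[\mathbf 1]_{\vec d_\pm}$ record where it lies. **Theorem.** (1) For all $d_+\in\mathbb K_+$, $d_-\in\mathbb K_-$ with $d_+-d_-\in\mathbb Q e$, the components of $H_{(Z_+,D_{Z,+})}$ of class $d_+$ (label $[d_+],\vec d_+$) and of $H_{(Z_-,D_{Z,-})}$ of class $d_-$ (label $[d_-],\vec d_-$) agree under the change of variables, up to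 the shift of the monomial by a power of $y_r$ alone: $$H_{+,d_+}(y)=y_r^{\,p_r^+\cdot(d_+-d_-)}\;H_{-,d_-}(\tilde y)$$ as power series in the classes of the characters, and hence also for their images in every common quotient of the two cohomology rings in which the classes of each character are identified. In particular $H_{+,d}(y)=H_{-,d}(\tilde y)$ for $d\in\mathbb K_+\cap\mathbb K_-$. (2) Without wall-crossing, for $X_+=X_-=\mathbb P^4$, $L_1=\mathcal O(1)$, $L_2=\mathcal O(4)$ (so that the pairs are $(\mathbb P^3,K3)$ and $(Q_4,K3)$, all five toric divisors enter the denominator, and there are no toric relative divisors), the sums of all contributions of given contact order satisfy $H_{(\mathbb P^3,K3),4k}(y)=H_{(Q_4,K3),k}(y)$ in $H^*(\mathbb P^4)$ for every integer $k$. -/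

import Mathlib

noncomputable section

namespace ToricExchange

/-! ### Toric GIT data

The torus is `K = (ℂˣ)^r`, with cocharacter lattice `𝕃 = ℤ^r` and character lattice `𝕃^∨ = ℤ^r`,
paired by the dot product. The data are characters `D 1, …, D m` and a stability condition `ω`. -/

/-- A rational number that is an integer. -/
def IsInt (q : ℚ) : Prop := ∃ k : ℤ, (k : ℚ) = q

/-- An integral character, seen in `𝕃^∨ ⊗ ℚ`. -/
def toRat {r : ℕ} (θ : Fin r → ℤ) : Fin r → ℚ := fun j => (θ j : ℚ)

/-- An element of `𝕃^∨ ⊗ ℚ`, seen in `𝕃^∨ ⊗ ℝ`. -/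
def toReal {r : ℕ} (θ : Fin r → ℚ) : Fin r → ℝ := fun j => (θ j : ℝ)

/-- An element of `𝕃^∨ ⊗ ℚ`, seen in `𝕃^∨ ⊗ ℂ`. -/
def toComplex {r : ℕ} (θ : Fin r → ℚ) : Fin r → ℂ := fun j => (θ j : ℂ)

/-- The cone `∠_I` of strictly positive combinations of the `D i`, `i ∈ I`. -/
def openCone {m r : ℕ} (D : Fin m → Fin r → ℤ) (I : Set (Fin m)) : Set (Fin r → ℝ) :=
  {θ | ∃ a : Fin m → ℝ, (∀ i ∈ I, 0 < a i) ∧ (∀ i, i ∉ I → a i = 0) ∧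
    θ = ∑ i, a i • toReal (toRat (D i))}

/-- The anticones: `I ∈ 𝒜_ω` if and only if `ω ∈ ∠_I`. -/
def IsAnticone {m r : ℕ} (D : Fin m → Fin r → ℤ) (ω : Fin r → ℝ) (I : Set (Fin m)) : Prop :=
  ω ∈ openCone D I

/-- The extended ample cone `C_ω`, the intersection of the `∠_I` for `I ∈ 𝒜_ω`. -/
def chamber {m r : ℕ} (D : Fin m → Fin r → ℤ) (ω : Fin r → ℝ) : Set (Fin r → ℝ) :=
  {θ | ∀ I, IsAnticone D ω I → θ ∈ openCone D I}

/-- `ω` lies in the nonnegative span of the characters and `C_ω` has maximal dimension, so that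
`X_ω = [𝒰_ω / K]` is a nonempty Deligne--Mumford stack. -/
structure IsStability {m r : ℕ} (D : Fin m → Fin r → ℤ) (ω : Fin r → ℝ) : Prop where
  mem_span : ∃ a : Fin m → ℝ, (∀ i, 0 ≤ a i) ∧ ω = ∑ i, a i • toReal (toRat (D i))
  full : Submodule.span ℝ (chamber D ω) = ⊤

/-- The set `𝕂` of all `d ∈ 𝕃 ⊗ ℚ` such that `{i | D_i · d ∈ ℤ}` is an anticone. -/
def curveClasses {m r : ℕ} (D : Fin m → Fin r → ℤ) (ω : Fin r → ℝ) : Set (Fin r → ℚ) :=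
  {d | IsAnticone D ω {i | IsInt (toRat (D i) ⬝ᵥ d)}}

/-- The lattice `𝕃` inside `𝕃 ⊗ ℚ`. -/
def lattice (r : ℕ) : AddSubgroup (Fin r → ℚ) :=
  ((Int.castAddHom ℚ).compLeft (Fin r)).range

/-- The indices `f` of the sectors: classes in `(𝕃 ⊗ ℚ) / 𝕃` (those of elements of `𝕂` give the
nonempty sectors `X_ω^f` of the inertia stack). -/
abbrev Sector (r : ℕ) : Type := (Fin r → ℚ) ⧸ lattice r

/-- `S`: the indices `i` for which the complement of `{i}` is not an anticone. -/
def extendedIndices {m r : ℕ} (D : Fin m → Fin r → ℤ) (ω : Fin r → ℝ) : Set (Fin m) :=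
  {i | ¬ IsAnticone D ω {i}ᶜ}

/-- The line bundle on `X_ω` of the character `E` is pulled back from the coarse moduli space: `E`
is trivial on the stabilizers of `X_ω`, which are the groups of those `d ∈ 𝕃 ⊗ ℚ` modulo `𝕃` with
`D_i · d ∈ ℤ` for all `i` in a given anticone. -/
def FromCoarse {m r : ℕ} (D : Fin m → Fin r → ℤ) (ω : Fin r → ℝ) (E : Fin r → ℤ) : Prop :=
  ∀ d ∈ curveClasses D ω, IsInt (toRat E ⬝ᵥ d)

/-- A basis of `𝕃^∨ ⊗ ℚ` that is a `ℤ`-basis of `𝕃̃^∨ = Hom(𝕃̃, ℤ)`, where `𝕃̃` is the group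
generated by `𝕂`, and whose members lie in the closure of the extended ample cone. -/
structure IsChart {m r : ℕ} (D : Fin m → Fin r → ℤ) (ω : Fin r → ℝ)
    (p : Module.Basis (Fin r) ℚ (Fin r → ℚ)) : Prop where
  integral : ((Submodule.span ℤ (Set.range p) : Submodule ℤ (Fin r → ℚ)) : Set (Fin r → ℚ)) =
    {θ | ∀ d ∈ curveClasses D ω, IsInt (θ ⬝ᵥ d)}
  nef : ∀ a, toReal (p a) ∈ closure (chamber D ω)

/-! ### Ambient cohomology -/

/-- Formal power series in the first Chern classes of the characters of `K`, i.e. the completion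
of `Sym(𝕃^∨ ⊗ ℂ) = H^*(BK; ℂ)`. -/
abbrev Series (r : ℕ) : Type := MvPowerSeries (Fin r) ℂ

/-- The class of an element of `𝕃^∨ ⊗ ℂ`. -/
def chern {r : ℕ} (θ : Fin r → ℂ) : Series r :=
  ∑ j, MvPowerSeries.C (θ j) * MvPowerSeries.X j

/-- The coordinates `z_i` that are not identically zero on the intersection of the sector `X_ω^f`
with the divisors `{z_i = 0}` for which `i ∈ rel` has nonzero contact order `s i`. -/
def stratum {m r : ℕ} (D : Fin m → Fin r → ℤ) (rel : Finset (Fin m)) (f : Sector r)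
    (s : rel → ℚ) : Set (Fin m) :=
  {i | (∃ d : Fin r → ℚ, (d : Sector r) = f ∧ IsInt (toRat (D i) ⬝ᵥ d)) ∧
    ∀ h : i ∈ rel, s ⟨i, h⟩ = 0}

/-- The Stanley--Reisner ideal of the closed toric substack of `X_ω^f` described by `stratum`: it
is generated by the products of the `D_i`, `i ∈ J`, for those `J` such that the locus
`{z_i = 0 for all i ∈ J}` of the substack is empty. -/
def strataIdeal {m r : ℕ} (D : Fin m → Fin r → ℤ) (ω : Fin r → ℝ) (rel : Finset (Fin m))
    (f : Sector r) (s : rel → ℚ) : Ideal (Series r) :=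
  Ideal.span {g | ∃ J : Finset (Fin m), (J : Set (Fin m)) ⊆ stratum D rel f s ∧
    ¬ IsAnticone D ω (stratum D rel f s \ (J : Set (Fin m))) ∧
    g = ∏ i ∈ J, chern (toComplex (toRat (D i)))}

/-- The cohomology ring with complex coefficients of that toric substack, in its Stanley--Reisner
presentation. The ambient classes of a pair in `X_ω` are the restrictions of these classes. All classes of positive degree are nilpotent in it, so that power series and
polynomials in the classes of the characters have the same quotient. -/
abbrev Coh {m r : ℕ} (D : Fin m → Fin r → ℤ) (ω : Fin r → ℝ) (rel : Finset (Fin m))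
    (f : Sector r) (s : rel → ℚ) : Type := Series r ⧸ strataIdeal D ω rel f s

/-! ### Relative `H`-functions -/

/-- The discrete data of a pair `(Z, D_Z)` in `X = X_ω`: here `Z` is the zero locus of a regular
section of the line bundle of the character `cut`, and `D_Z` is the intersection of `Z` with the
zero locus of a regular section of the line bundle of the character `div` and with the toric
divisors `{z_i = 0}`, `i ∈ rel`. The toric divisors with index in `free` are those that enter the
`H`-function through a Gamma factor. The ambient `H`-function depends on nothing else. -/
structure RelPair (m r : ℕ) where
  D : Fin m → Fin r → ℤ
  ω : Fin r → ℝ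
  free : Finset (Fin m)
  rel : Finset (Fin m)
  cut : Fin r → ℤ
  div : Fin r → ℤ

/-- The labels `(f, vec d)` of the components: a sector, the contact orders along the toric
divisors of the pair, and the contact order along the divisor given by `div`. -/
abbrev Label {m r : ℕ} (P : RelPair m r) : Type := Sector r × (P.rel → ℚ) × ℚ

/-- The label `([d], (D_i · d)_{i ∈ rel}, div · d)` of a class `d`. -/
def label {m r : ℕ} (P : RelPair m r) (d : Fin r → ℚ) : Label P :=
  ((d : Sector r), fun i => toRat (P.D i) ⬝ᵥ d, toRat P.div ⬝ᵥ d)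

/-- The Taylor series of `f` at `c`. -/
def taylorAt (f : ℂ → ℂ) (c : ℂ) : PowerSeries ℂ :=
  PowerSeries.mk fun k => iteratedDeriv k f c / (Nat.factorial k : ℂ)

/-- The class `x / (2 π i)` of a character `x`. -/
def normalized {r : ℕ} (θ : Fin r → ℤ) : Series r :=
  chern ((2 * (Real.pi : ℂ) * Complex.I)⁻¹ • toComplex (toRat θ))

/-- `Γ(1 + x / (2 π i) + x · d)` for a character `x`. -/
def gammaClass {r : ℕ} (θ : Fin r → ℤ) (d : Fin r → ℚ) : Series r :=
  (taylorAt Complex.Gamma (1 + ((toRat θ ⬝ᵥ d : ℚ) : ℂ))).subst (normalized θ)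

/-- `1 / Γ(1 + x / (2 π i) + x · d)` for a character `x`. -/
def invGammaClass {r : ℕ} (θ : Fin r → ℤ) (d : Fin r → ℚ) : Series r :=
  (taylorAt (fun z => (Complex.Gamma z)⁻¹) (1 + ((toRat θ ⬝ᵥ d : ℚ) : ℂ))).subst (normalized θ)

/-- The monomial `y^d = ∏ y_a ^ (p_a · d)`, where `y_a = exp (logy a)`. -/
def monomialAt {r : ℕ} (p : Fin r → Fin r → ℚ) (logy : Fin r → ℂ) (d : Fin r → ℚ) : ℂ :=
  Complex.exp (∑ a, ((p a ⬝ᵥ d : ℚ) : ℂ) * logy a)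

/-- `exp (t / (2 π i))` with `t = ∑ p_a log y_a`. -/
def expClass {r : ℕ} (p : Fin r → Fin r → ℚ) (logy : Fin r → ℂ) : Series r :=
  (PowerSeries.exp ℂ).subst
    (chern ((2 * (Real.pi : ℂ) * Complex.I)⁻¹ • ∑ a, logy a • toComplex (p a)))

/-- The coefficient of `1_[d] [1]_(vec d)` in the summand of class `d` of the `H`-function,
`exp (t / 2πi) y^d ∏_{v = cut, div} Γ(1 + v / 2πi + v·d) / ∏_{i ∈ free} Γ(1 + D_i / 2πi + D_i·d)`,
as a power series in the classes of the characters. The `H`-function is a function of `log y`.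
The classes that pair negatively with one of the two nef characters `cut` and `div` (where the
Gamma factor has a pole) are not effective and do not contribute. -/
def hSeries {m r : ℕ} (P : RelPair m r) (p : Fin r → Fin r → ℚ) (logy : Fin r → ℂ)
    (d : Fin r → ℚ) : Series r :=
  if 0 ≤ toRat P.cut ⬝ᵥ d ∧ 0 ≤ toRat P.div ⬝ᵥ d then
    monomialAt p logy d •
      (expClass p logy * (gammaClass P.cut d * gammaClass P.div d) *
        ∏ i ∈ P.free, invGammaClass (P.D i) d)
  else 0

open scoped Classical in
/-- The same for the summand of class `d` and an arbitrary label: the summand is supported on the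
label of `d`. -/
def hSeriesAt {m r : ℕ} (P : RelPair m r) (p : Fin r → Fin r → ℚ) (logy : Fin r → ℂ)
    (d : Fin r → ℚ) (l : Label P) : Series r :=
  if label P d = l then hSeries P p logy d else 0

/-- The component with label `l` of the summand of class `d` of the ambient relative
`H`-function, with its value in the cohomology of the stratum that belongs to `l`. -/
def hComponent {m r : ℕ} (P : RelPair m r) (p : Fin r → Fin r → ℚ) (logy : Fin r → ℂ)
    (d : Fin r → ℚ) (l : Label P) : Coh P.D P.ω P.rel l.1 l.2.1 :=
  Ideal.Quotient.mk _ (hSeriesAt P p logy d l)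

/-- The sum over all classes `d ∈ 𝕂` of the components with label `l`, used only where at most
finitely many summands do not vanish. -/
def hTotal {m r : ℕ} (P : RelPair m r) (p : Fin r → Fin r → ℚ) (logy : Fin r → ℂ)
    (l : Label P) : Coh P.D P.ω P.rel l.1 l.2.1 :=
  ∑ᶠ d ∈ curveClasses P.D P.ω, hComponent P p logy d l

/-! ### Toric wall-crossing -/

/-- A single toric wall-crossing `X_+ ⇢ X_-` with `r = n + 1`. The wall is the hyperplane
`W = {θ | θ · e = 0}`. -/
structure WallCrossing (m n : ℕ) where
  D : Fin m → Fin (n + 1) → ℤ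
  ωp : Fin (n + 1) → ℝ
  ωm : Fin (n + 1) → ℝ
  stability_p : IsStability D ωp
  stability_m : IsStability D ωm
  e : Fin (n + 1) → ℤ
  /-- `e` is a primitive lattice vector, hence a primitive generator of `W^⊥`. -/
  primitive : ∀ k : ℤ, (∀ j, k ∣ e j) → IsUnit k
  e_pos : 0 < ωp ⬝ᵥ toReal (toRat e)
  e_neg : ωm ⬝ᵥ toReal (toRat e) < 0
  /-- The two chambers lie on different sides of `W`. -/
  side_p : ∀ θ ∈ chamber D ωp, 0 ≤ θ ⬝ᵥ toReal (toRat e)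
  side_m : ∀ θ ∈ chamber D ωm, θ ⬝ᵥ toReal (toRat e) ≤ 0
  /-- The closed chambers have the same intersection with `W`, and it is a facet of both. -/
  common_wall : {θ ∈ closure (chamber D ωp) | θ ⬝ᵥ toReal (toRat e) = 0} =
    {θ ∈ closure (chamber D ωm) | θ ⬝ᵥ toReal (toRat e) = 0}
  facet : ((Submodule.span ℝ {θ ∈ closure (chamber D ωp) | θ ⬝ᵥ toReal (toRat e) = 0} :
    Submodule ℝ (Fin (n + 1) → ℝ)) : Set (Fin (n + 1) → ℝ)) = {θ | θ ⬝ᵥ toReal (toRat e) = 0}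

namespace WallCrossing

variable {m n : ℕ} (W : WallCrossing m n)

/-- The closed cone of the wall. -/
def closedWall : Set (Fin (n + 1) → ℝ) :=
  {θ ∈ closure (chamber W.D W.ωp) | θ ⬝ᵥ toReal (toRat W.e) = 0}

/-- `M_0 = {i | D_i · e = 0}`. -/
def M0 : Finset (Fin m) := {i | W.D i ⬝ᵥ W.e = 0}

open scoped Classical in
/-- `I_+ = (M_+ ∪ M_-) \ S_+`. -/
def Ip : Finset (Fin m) := {i | W.D i ⬝ᵥ W.e ≠ 0 ∧ i ∉ extendedIndices W.D W.ωp}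

open scoped Classical in
/-- `I_- = (M_+ ∪ M_-) \ S_-`. -/
def Im : Finset (Fin m) := {i | W.D i ⬝ᵥ W.e ≠ 0 ∧ i ∉ extendedIndices W.D W.ωm}

/-- The assumptions on the characters of the line bundles. -/
structure Admissible (E : Fin (n + 1) → ℤ) : Prop where
  mem_wall : toReal (toRat E) ∈ W.closedWall
  coarse_p : FromCoarse W.D W.ωp E
  coarse_m : FromCoarse W.D W.ωm E

/-- The pair `(Z_+, D_{Z,+})` in `X_+`: the first line bundle cuts out `Z_+`, the second one gives
a component of the divisor. -/
def pairP (E₁ E₂ : Fin (n + 1) → ℤ) : RelPair m (n + 1) where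
  D := W.D
  ω := W.ωp
  free := W.M0
  rel := W.Ip
  cut := E₁
  div := E₂

/-- The pair `(Z_-, D_{Z,-})` in `X_-`: the second line bundle cuts out `Z_-`, the first one gives
a component of the divisor. -/
def pairM (E₁ E₂ : Fin (n + 1) → ℤ) : RelPair m (n + 1) where
  D := W.D
  ω := W.ωm
  free := W.M0
  rel := W.Im
  cut := E₂
  div := E₁

/-- Bases for the coordinates `y` of `X_+` and `ỹ` of `X_-` that share all members but the last;
the shared ones lie on the wall. -/
structure Charts (pp pm : Module.Basis (Fin (n + 1)) ℚ (Fin (n + 1) → ℚ)) : Prop where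
  chart_p : IsChart W.D W.ωp pp
  chart_m : IsChart W.D W.ωm pm
  common : ∀ i : Fin n, pp i.castSucc = pm i.castSucc
  mem_wall : ∀ i : Fin n, toReal (pp i.castSucc) ∈ W.closedWall

/-- The change of variables `ỹ_i = y_i y_r ^ c_i` for `i < r` and `ỹ_r = y_r ^ (-c)`, in terms of
logarithms, with `c = -(p_r^+ · e) / (p_r^- · e)` and with `c_i` the `i`-th coordinate of `p_r^+`
in the basis `p^-`. -/
def changeVars (pp pm : Module.Basis (Fin (n + 1)) ℚ (Fin (n + 1) → ℚ))
    (logy : Fin (n + 1) → ℂ) : Fin (n + 1) → ℂ :=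
  Fin.snoc (α := fun _ => ℂ)
    (fun i : Fin n => logy i.castSucc +
      ((pm.repr (pp (Fin.last n)) i.castSucc : ℚ) : ℂ) * logy (Fin.last n))
    (-((-(pp (Fin.last n) ⬝ᵥ toRat W.e) / (pm (Fin.last n) ⬝ᵥ toRat W.e) : ℚ) : ℂ) *
      logy (Fin.last n))

end WallCrossing

/-- The common quotient of the cohomology rings of a stratum of `X_+` and a stratum of `X_-`,
obtained by identifying in their tensor product the classes of each character of `K`. -/
abbrev CommonCoh {m r : ℕ} (P Q : RelPair m r) (l : Label P) (l' : Label Q) : Type :=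
  Series r ⧸ (strataIdeal P.D P.ω P.rel l.1 l.2.1 ⊔ strataIdeal Q.D Q.ω Q.rel l'.1 l'.2.1)

/-- The quotient map from the cohomology ring of the first stratum. -/
def toCommonLeft {m r : ℕ} (P Q : RelPair m r) (l : Label P) (l' : Label Q) :
    Coh P.D P.ω P.rel l.1 l.2.1 →+* CommonCoh P Q l l' :=
  Ideal.Quotient.factor le_sup_left

/-- The quotient map from the cohomology ring of the second stratum. -/
def toCommonRight {m r : ℕ} (P Q : RelPair m r) (l : Label P) (l' : Label Q) :
    Coh Q.D Q.ω Q.rel l'.1 l'.2.1 →+* CommonCoh P Q l l' :=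
  Ideal.Quotient.factor le_sup_right

/-! ### Projective space of dimension four -/

/-- A pair in `ℙ⁴` given by a hypersurface of degree `a` and its intersection with a hypersurface
of degree `b`. There is no wall, so all five toric divisors are in `free`. -/
def p4Pair (a b : ℤ) : RelPair 5 1 where
  D := fun _ _ => 1
  ω := fun _ => 1
  free := Finset.univ
  rel := ∅
  cut := fun _ => a
  div := fun _ => b

end ToricExchange

end

namespace ToricExchange

/-! Each ingredient of a summand either is constant in the direction `e` or transforms by a change
of basis. The characters `E₁`, `E₂` on the wall and the `D i` with `i ∈ M0` annihilate `e`, so their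
Gamma factors and the effectivity condition take the same values at `dp` and `dm`. Exchanging the
bundles changes nothing, since the numerator is symmetric in them. The change of variables is dual
to the passage from `pp` to `pm` (`Charts.sum_changeVars`). Hence the exponential factors agree, and
the monomials differ only through the last vector of `pp`, because the shared vectors annihilate
`e`. `Charts.hSeries_eq` combines these facts before any quotient is taken, so the identity descends
to every common quotient. On `ℙ⁴` a contact order determines the degree, so each total is a single
summand (`hTotal_p4Pair`), and the same symmetry concludes. -/

lemma toRat_dotProduct_toRat {r : ℕ} (x y : Fin r → ℤ) :
    toRat x ⬝ᵥ toRat y = ((x ⬝ᵥ y : ℤ) : ℚ) := by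
  simp [dotProduct, toRat]

lemma toReal_dotProduct_toReal {r : ℕ} (x y : Fin r → ℚ) :
    toReal x ⬝ᵥ toReal y = ((x ⬝ᵥ y : ℚ) : ℝ) := by
  simp [dotProduct, toReal]

/-- Characters that vanish on `e` do not distinguish classes that differ by a multiple of `e`. -/
lemma dotProduct_eq_of_sub_eq_smul {r : ℕ} {θ e d d' : Fin r → ℚ} {q : ℚ}
    (h : d - d' = q • e) (hθ : θ ⬝ᵥ e = 0) : θ ⬝ᵥ d = θ ⬝ᵥ d' := by
  rw [← sub_eq_zero, ← dotProduct_sub, h, dotProduct_smul, hθ, smul_zero]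

lemma gammaClass_congr {r : ℕ} {θ : Fin r → ℤ} {d d' : Fin r → ℚ}
    (h : toRat θ ⬝ᵥ d = toRat θ ⬝ᵥ d') : gammaClass θ d = gammaClass θ d' := by
  simp only [gammaClass, h]

lemma invGammaClass_congr {r : ℕ} {θ : Fin r → ℤ} {d d' : Fin r → ℚ}
    (h : toRat θ ⬝ᵥ d = toRat θ ⬝ᵥ d') : invGammaClass θ d = invGammaClass θ d' := by
  simp only [invGammaClass, h]

lemma hSeriesAt_label {m r : ℕ} (P : RelPair m r) (p : Fin r → Fin r → ℚ) (logy : Fin r → ℂ)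
    (d : Fin r → ℚ) : hSeriesAt P p logy d (label P d) = hSeries P p logy d :=
  if_pos rfl

/-! ### Wall-crossing: change of basis and invariance along `e`. -/

namespace WallCrossing

variable {m n : ℕ} (W : WallCrossing m n)

lemma dotProduct_e_of_mem_closedWall {θ : Fin (n + 1) → ℚ} (h : toReal θ ∈ W.closedWall) :
    θ ⬝ᵥ toRat W.e = 0 := by
  have := h.2
  rw [toReal_dotProduct_toReal] at this
  exact_mod_cast this

lemma e_ne_zero : toRat W.e ≠ 0 := by
  intro h
  have := W.e_pos
  rw [h] at this
  simp [toReal, dotProduct] at this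

variable {W} {pp pm : Module.Basis (Fin (n + 1)) ℚ (Fin (n + 1) → ℚ)}

lemma Charts.dotProduct_e (h : W.Charts pp pm) (i : Fin n) :
    pm i.castSucc ⬝ᵥ toRat W.e = 0 := by
  rw [← h.common i]
  exact W.dotProduct_e_of_mem_closedWall (h.mem_wall i)

/-- Otherwise `e` would pair to zero with a whole basis and vanish. This makes the quotient defining
`c` meaningful. -/
lemma Charts.last_dotProduct_e_ne_zero (h : W.Charts pp pm) :
    pm (Fin.last n) ⬝ᵥ toRat W.e ≠ 0 := by
  intro h0
  refine W.e_ne_zero (dotProduct_eq_zero _ fun v => ?_)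
  rw [dotProduct_comm, ← pm.sum_repr v, sum_dotProduct]
  refine Finset.sum_eq_zero fun i _ => ?_
  rw [smul_dotProduct]
  refine Fin.lastCases ?_ (fun j => ?_) i
  · rw [h0, smul_zero]
  · rw [h.dotProduct_e, smul_zero]

/-- The exponent of the last coordinate in the change of variables is the last coordinate of
`p_r^+` in the basis `p^-`. -/
lemma Charts.repr_last (h : W.Charts pp pm) :
    pm.repr (pp (Fin.last n)) (Fin.last n) =
      (pp (Fin.last n) ⬝ᵥ toRat W.e) / (pm (Fin.last n) ⬝ᵥ toRat W.e) := by
  rw [eq_div_iff h.last_dotProduct_e_ne_zero]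
  conv_rhs => rw [← pm.sum_repr (pp (Fin.last n))]
  rw [sum_dotProduct, Fin.sum_univ_castSucc]
  simp [smul_dotProduct, h.dotProduct_e]

/-- The change of variables is dual to the change of bases, for every linear functional. -/
lemma Charts.sum_changeVars (h : W.Charts pp pm) (f : (Fin (n + 1) → ℚ) →ₗ[ℚ] ℂ)
    (logy : Fin (n + 1) → ℂ) :
    ∑ a, f (pm a) * W.changeVars pp pm logy a = ∑ a, f (pp a) * logy a := by
  have hlast : f (pp (Fin.last n)) =
      ∑ i : Fin n, ((pm.repr (pp (Fin.last n)) i.castSucc : ℚ) : ℂ) * f (pm i.castSucc) +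
        ((pm.repr (pp (Fin.last n)) (Fin.last n) : ℚ) : ℂ) * f (pm (Fin.last n)) := by
    conv_lhs => rw [← pm.sum_repr (pp (Fin.last n))]
    rw [map_sum, Fin.sum_univ_castSucc]
    simp only [map_smul, Rat.smul_def]
  rw [Fin.sum_univ_castSucc, Fin.sum_univ_castSucc, hlast, h.repr_last]
  simp only [changeVars, Fin.snoc_castSucc, Fin.snoc_last, h.common, mul_add,
    Finset.sum_add_distrib, add_mul, Finset.sum_mul, add_assoc]
  congr 1
  congr 1
  · exact Finset.sum_congr rfl fun i _ => by ring
  -- The sign in the exponent `-c` cancels the sign in the definition of `c`.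
  · push_cast
    ring

/-- The exponents `t_+` and `t_-` coincide: apply `Charts.sum_changeVars` to each coordinate
functional. -/
lemma Charts.expClass_eq (h : W.Charts pp pm) (logy : Fin (n + 1) → ℂ) :
    expClass pp logy = expClass pm (W.changeVars pp pm logy) := by
  have : ∑ a, logy a • toComplex (pp a) =
      ∑ a, W.changeVars pp pm logy a • toComplex (pm a) := by
    funext j
    have := h.sum_changeVars ((Algebra.linearMap ℚ ℂ).comp (LinearMap.proj j)) logy
    simpa [toComplex, mul_comm, Finset.sum_apply] using this.symm
  rw [expClass, expClass, this]

/-- Duality for the functional "pair with `dm`" rewrites the right-hand monomial in the basis `pp`;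
replacing `dm` by `dp` then affects only the last exponent. -/
lemma Charts.monomialAt_eq (h : W.Charts pp pm) (logy : Fin (n + 1) → ℂ)
    {dp dm : Fin (n + 1) → ℚ} {q : ℚ} (hd : dp - dm = q • toRat W.e) :
    monomialAt pp logy dp =
      Complex.exp (((pp (Fin.last n) ⬝ᵥ (dp - dm) : ℚ) : ℂ) * logy (Fin.last n)) *
        monomialAt pm (W.changeVars pp pm logy) dm := by
  have key := h.sum_changeVars
    ((Algebra.linearMap ℚ ℂ).comp ((dotProductBilin ℚ ℚ).flip dm)) logy
  simp only [LinearMap.comp_apply, LinearMap.flip_apply, Algebra.linearMap_apply,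
    dotProductBilin_apply_apply, eq_ratCast] at key
  rw [monomialAt, monomialAt, ← Complex.exp_add, key, Fin.sum_univ_castSucc,
    Fin.sum_univ_castSucc]
  have hc (i : Fin n) : pp i.castSucc ⬝ᵥ dp = pp i.castSucc ⬝ᵥ dm :=
    dotProduct_eq_of_sub_eq_smul hd (by rw [h.common, h.dotProduct_e])
  simp only [hc, dotProduct_sub]
  congr 1
  push_cast
  ring

/-- The summands of the two `H`-functions agree up to a power of the last coordinate. -/
lemma Charts.hSeries_eq (h : W.Charts pp pm) {E₁ E₂ : Fin (n + 1) → ℤ}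
    (h₁ : W.Admissible E₁) (h₂ : W.Admissible E₂) {dp dm : Fin (n + 1) → ℚ} {q : ℚ}
    (hd : dp - dm = q • toRat W.e) (logy : Fin (n + 1) → ℂ) :
    hSeries (W.pairP E₁ E₂) pp logy dp =
      Complex.exp (((pp (Fin.last n) ⬝ᵥ (dp - dm) : ℚ) : ℂ) * logy (Fin.last n)) •
        hSeries (W.pairM E₁ E₂) pm (W.changeVars pp pm logy) dm := by
  have e₁ := dotProduct_eq_of_sub_eq_smul hd (W.dotProduct_e_of_mem_closedWall h₁.mem_wall)
  have e₂ := dotProduct_eq_of_sub_eq_smul hd (W.dotProduct_e_of_mem_closedWall h₂.mem_wall)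
  have eM : ∏ i ∈ W.M0, invGammaClass (W.D i) dp = ∏ i ∈ W.M0, invGammaClass (W.D i) dm := by
    refine Finset.prod_congr rfl fun i hi => invGammaClass_congr ?_
    refine dotProduct_eq_of_sub_eq_smul hd ?_
    rw [toRat_dotProduct_toRat, (Finset.mem_filter.1 hi).2, Int.cast_zero]
  -- The exchange of `cut` and `div` only reverses the order of the two inequalities.
  have hP : (0 ≤ toRat (W.pairP E₁ E₂).cut ⬝ᵥ dp ∧ 0 ≤ toRat (W.pairP E₁ E₂).div ⬝ᵥ dp) ↔
      0 ≤ toRat (W.pairM E₁ E₂).cut ⬝ᵥ dm ∧ 0 ≤ toRat (W.pairM E₁ E₂).div ⬝ᵥ dm := by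
    simp only [pairP, pairM, e₁, e₂, and_comm]
  by_cases hM : 0 ≤ toRat (W.pairM E₁ E₂).cut ⬝ᵥ dm ∧ 0 ≤ toRat (W.pairM E₁ E₂).div ⬝ᵥ dm
  · rw [hSeries, hSeries, if_pos (hP.2 hM), if_pos hM, smul_smul,
      h.monomialAt_eq logy hd, h.expClass_eq logy]
    simp only [pairP, pairM, eM, gammaClass_congr e₁, gammaClass_congr e₂,
      mul_comm (gammaClass E₁ dm)]
  · rw [hSeries, hSeries, if_neg (mt hP.1 hM), if_neg hM, smul_zero]

end WallCrossing

/-! ### The example of `ℙ⁴`. -/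

lemma toRat_const_dotProduct (c : ℤ) (d : Fin 1 → ℚ) :
    toRat (fun _ => c) ⬝ᵥ d = (c : ℚ) * d 0 := by
  simp [toRat, dotProduct]

lemma const_mem_curveClasses_p4Pair (a b k : ℤ) :
    (fun _ => (k : ℚ)) ∈ curveClasses (p4Pair a b).D (p4Pair a b).ω := by
  have hI (i : Fin 5) : IsInt (toRat ((p4Pair a b).D i) ⬝ᵥ fun _ => (k : ℚ)) :=
    ⟨k, by simp [p4Pair, toRat, dotProduct]⟩
  -- All five characters equal `1 = ω`, so equal weights summing to `1` exhibit `ω` in the open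
  -- cone.
  refine ⟨fun _ => 1 / 5, fun _ _ => by norm_num, fun i hi => (hi (hI i)).elim, ?_⟩
  funext j
  simp [p4Pair, toReal, toRat]

/-- In `ℙ⁴` the only class in the untwisted sector with contact order `b * k` is `k`. -/
lemma label_p4Pair_eq_iff {a b : ℤ} (hb : b ≠ 0) (k : ℤ) (d : Fin 1 → ℚ) :
    label (p4Pair a b) d = (0, fun _ => 0, (b : ℚ) * k) ↔ d = fun _ => (k : ℚ) := by
  have hb' : (b : ℚ) ≠ 0 := by exact_mod_cast hb
  have hdiv : toRat (p4Pair a b).div ⬝ᵥ d = (b : ℚ) * d 0 := toRat_const_dotProduct b d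
  constructor
  · intro h
    have h2 : toRat (p4Pair a b).div ⬝ᵥ d = (b : ℚ) * k := congrArg (fun l => l.2.2) h
    rw [hdiv] at h2
    funext j
    rw [Subsingleton.elim j 0]
    exact mul_left_cancel₀ hb' h2
  · intro h
    refine Prod.ext ?_ (Prod.ext ?_ ?_)
    · rw [h]
      exact (QuotientAddGroup.eq_zero_iff _).2 ⟨fun _ => k, rfl⟩
    · funext i
      exact (Finset.notMem_empty _ i.2).elim
    · change toRat (p4Pair a b).div ⬝ᵥ d = _
      rw [hdiv, h]

/-- As `b ≠ 0`, the contact order singles out one class, and the sum collapses to it. -/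
lemma hTotal_p4Pair {a b : ℤ} (hb : b ≠ 0) (p : Fin 1 → Fin 1 → ℚ) (logy : Fin 1 → ℂ) (k : ℤ) :
    hTotal (p4Pair a b) p logy (0, fun _ => 0, (b : ℚ) * k) =
      Ideal.Quotient.mk _ (hSeries (p4Pair a b) p logy fun _ => (k : ℚ)) := by
  rw [hTotal, finsum_eq_single _ (fun _ => (k : ℚ))]
  · simp only [const_mem_curveClasses_p4Pair a b k, finsum_true]
    rw [hComponent, hSeriesAt, if_pos ((label_p4Pair_eq_iff hb k _).2 rfl)]
  · intro d hd
    rw [hComponent, hSeriesAt, if_neg (mt (label_p4Pair_eq_iff hb k d).1 hd), map_zero]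
    simp

lemma hSeries_p4Pair_comm (a b : ℤ) (p : Fin 1 → Fin 1 → ℚ) (logy : Fin 1 → ℂ)
    (d : Fin 1 → ℚ) : hSeries (p4Pair a b) p logy d = hSeries (p4Pair b a) p logy d := by
  simp only [hSeries, p4Pair, mul_comm (gammaClass (fun _ => a) d),
    and_comm (a := 0 ≤ toRat (fun _ => a) ⬝ᵥ d)]
  congr

end ToricExchange

open ToricExchange in
theorem mainTheorem3 :
    (∀ (m n : ℕ) (W : WallCrossing m n) (E₁ E₂ : Fin (n + 1) → ℤ),
      W.Admissible E₁ → W.Admissible E₂ →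
      ∀ (pp pm : Module.Basis (Fin (n + 1)) ℚ (Fin (n + 1) → ℚ)), W.Charts pp pm →
      ∀ dp ∈ curveClasses W.D W.ωp, ∀ dm ∈ curveClasses W.D W.ωm,
        (∃ q : ℚ, dp - dm = q • toRat W.e) →
      ∀ logy : Fin (n + 1) → ℂ,
        hSeriesAt (W.pairP E₁ E₂) pp logy dp (label (W.pairP E₁ E₂) dp) =
            Complex.exp (((pp (Fin.last n) ⬝ᵥ (dp - dm) : ℚ) : ℂ) * logy (Fin.last n)) •
              hSeriesAt (W.pairM E₁ E₂) pm (W.changeVars pp pm logy) dm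
                (label (W.pairM E₁ E₂) dm) ∧
          toCommonLeft (W.pairP E₁ E₂) (W.pairM E₁ E₂)
              (label (W.pairP E₁ E₂) dp) (label (W.pairM E₁ E₂) dm)
              (hComponent (W.pairP E₁ E₂) pp logy dp (label (W.pairP E₁ E₂) dp)) =
            Complex.exp (((pp (Fin.last n) ⬝ᵥ (dp - dm) : ℚ) : ℂ) * logy (Fin.last n)) •
              toCommonRight (W.pairP E₁ E₂) (W.pairM E₁ E₂)
                (label (W.pairP E₁ E₂) dp) (label (W.pairM E₁ E₂) dm)
                (hComponent (W.pairM E₁ E₂) pm (W.changeVars pp pm logy) dm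
                  (label (W.pairM E₁ E₂) dm)) ∧
          (dp = dm →
            hSeriesAt (W.pairP E₁ E₂) pp logy dp (label (W.pairP E₁ E₂) dp) =
              hSeriesAt (W.pairM E₁ E₂) pm (W.changeVars pp pm logy) dm
                (label (W.pairM E₁ E₂) dm))) ∧
    (∀ (logy : Fin 1 → ℂ) (k : ℤ),
      hTotal (p4Pair 1 4) (Pi.basisFun ℚ (Fin 1)) logy (0, fun _ => 0, 4 * (k : ℚ)) =
        hTotal (p4Pair 4 1) (Pi.basisFun ℚ (Fin 1)) logy (0, fun _ => 0, (k : ℚ))) := by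
  refine ⟨?_, fun logy k => ?_⟩
  · rintro m n W E₁ E₂ h₁ h₂ pp pm h dp - dm - ⟨q, hd⟩ logy
    have key := h.hSeries_eq h₁ h₂ hd logy
    refine ⟨?_, ?_, fun hdd => ?_⟩
    · rw [hSeriesAt_label, hSeriesAt_label, key]
    · rw [hComponent, hComponent, hSeriesAt_label, hSeriesAt_label, key]
      -- Both quotient maps are induced by the identity on power series, and scalars act on
      -- representatives.
      rfl
    · rw [hSeriesAt_label, hSeriesAt_label, key, hdd, sub_self, dotProduct_zero, Rat.cast_zero,
        zero_mul, Complex.exp_zero, one_smul]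
  · have hl := hTotal_p4Pair (a := 1) (b := 4) (by norm_num) (Pi.basisFun ℚ (Fin 1)) logy k
    have hr := hTotal_p4Pair (a := 4) (b := 1) one_ne_zero (Pi.basisFun ℚ (Fin 1)) logy k
    rw [Int.cast_ofNat] at hl
    rw [Int.cast_one, one_mul] at hr
    rw [hl, hr, hSeries_p4Pair_comm]
    -- The ideals on the two sides involve neither `cut`, `div` nor the last contact order, so both
    -- rings are the same quotient.
    rfl
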